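/- Let $E$ be a finite set and $\mathcal Q=(Q(x,y))_{x,y\in E}$ a Markov generator, i.e. $Q(x,y)\ge 0$ for $x\ne y$ and $\sum_{y}Q(x,y)=0$ for every $x$. Let $X=(X_t)_{t\ge 0}$ be a time-homogeneous continuous-time Markov chain on $E$ with right-continuous paths and generator $\mathcal Q$, under probabilities $(\mathbb P_x)_{x\in E}$ with $\mathbb P_x(X_0=x)=1$, and let $\mathcal M$ be the set of all $[0,+\infty]$-valued stopping times of the natural filtration of $X$. Let $\beta>0$ and let $\psi,\phi:E\to\mathbb R$ satisfy $0\le\psi\le\phi$. For $\tau,\gamma\in\mathcal M$ and $x\in E$ put $$R_x(\tau,\gamma)=\mathbb E_x\big[e^{-\beta\tau}\psi(X_\tau)\mathbf 1_{\{\tau\le\gamma\}}+e^{-\beta\gamma}\phi(X_\gamma)\mathbf 1_{\{\tau>\gamma\}}\big],\qquad V_0(x)=\sup_{\tau\in\mathcal M}\mathbb E_x\big[e^{-\beta\tau}\psi(X_\tau)\big],$$ with the convention $e^{-\beta\eta}f(X_\eta)=0$ on $\{\eta=+\infty\}$. For $A\subset E$ let $h(A)=\inf\{t\ge 0: X_t\in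 A\}$ (with $\inf\emptyset=+\infty$). Suppose that $\phi(x)\ge V_0(x)$ for all $x\in E$. Then the game has a value and it equals $V_0$: for all $x\in E$, $$\sup_{\tau\in\mathcal M}\inf_{\gamma\in\mathcal M}R_x(\tau,\gamma)=\inf_{\gamma\in\mathcal M}\sup_{\tau\in\mathcal M}R_x(\tau,\gamma)=V_0(x).$$ Moreover, the pair $(\tau^*,\gamma^*)=\big(h(\{V_0=\psi\}),\,h(\{V_0=\phi\})\big)$ is a Nash equilibrium: $\tau^*,\gamma^*\in\mathcal M$ and, for all $x\in E$ and all $\tau,\gamma\in\mathcal M$, $$R_x(\tau,\gamma^*)\le R_x(\tau^*,\gamma^*)\le R_x(\tau^*,\gamma).$$ -/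

import Mathlib

open MeasureTheory ProbabilityTheory
open scoped NNReal

/-- `Q` is a Markov generator on the finite set `E`: off-diagonal entries are nonnegative and
all rows sum to zero. -/
structure IsMarkovGenerator {E : Type*} [Fintype E] (Q : Matrix E E ℝ) : Prop where
  off_diag_nonneg : ∀ x y, x ≠ y → 0 ≤ Q x y
  row_sum_zero : ∀ x, ∑ y, Q x y = 0

/-- A time-homogeneous, right-continuous, continuous-time Markov chain `(X_t)_{t ≥ 0}` on the
finite discrete state space `E`, with generator `Q`, defined on one measurable space `Ω` that
carries a family of probabilities `(P x)_{x ∈ E}` with `P x (X_0 = x) = 1`. -/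
structure FiniteMarkovChain (E Ω : Type*) [Fintype E] [TopologicalSpace E] [DiscreteTopology E]
    [MeasurableSpace E] [BorelSpace E] [MeasurableSpace Ω] (Q : Matrix E E ℝ) where
  /-- the process -/
  X : ℝ≥0 → Ω → E
  /-- the family of probabilities -/
  P : E → Measure Ω
  isProbabilityMeasure : ∀ x, IsProbabilityMeasure (P x)
  measurable : ∀ t, Measurable (X t)
  right_continuous : ∀ ω t, ContinuousWithinAt (fun s => X s ω) (Set.Ici t) t
  start : ∀ x, P x {ω | X 0 ω = x} = 1
  /-- time-homogeneous Markov property: under `P x`, the conditional probability of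
  `X_{s+t} = y` given `𝓕_s = σ(X_r, r ≤ s)` is `P_{X_s} (X_t = y)` -/
  markov : ∀ (x : E) (s t : ℝ≥0) (y : E),
    (P x)[(X (s + t) ⁻¹' {y}).indicator (fun _ => (1 : ℝ)) |
        Filtration.natural X (fun r => (measurable r).stronglyMeasurable) s]
      =ᵐ[P x] fun ω => (P (X s ω)).real (X t ⁻¹' {y})
  /-- `Q` is the derivative at time zero of the transition matrices -/
  generator : ∀ x y : E,
    HasDerivWithinAt (fun t : ℝ => (P x).real (X t.toNNReal ⁻¹' {y})) (Q x y) (Set.Ici 0) 0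

namespace FiniteMarkovChain

variable {E Ω : Type*} [Fintype E] [TopologicalSpace E] [DiscreteTopology E]
  [MeasurableSpace E] [BorelSpace E] [MeasurableSpace Ω] {Q : Matrix E E ℝ}

/-- The natural filtration `𝓕_t = σ(X_s, s ≤ t)`. -/
noncomputable def filtration (C : FiniteMarkovChain E Ω Q) :
    Filtration ℝ≥0 (inferInstance : MeasurableSpace Ω) :=
  Filtration.natural C.X fun t => (C.measurable t).stronglyMeasurable

/-- The set `𝓜` of all `[0, ∞]`-valued stopping times of the natural filtration. -/
def stoppingTimes (C : FiniteMarkovChain E Ω Q) : Set (Ω → WithTop ℝ≥0) :=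
  {τ | IsStoppingTime C.filtration τ}

/-- The first hitting time `h(A) = inf {t ≥ 0 : X_t ∈ A}`, with value `∞` if `A` is never hit. -/
noncomputable def hit (C : FiniteMarkovChain E Ω Q) (A : Set E) : Ω → WithTop ℝ≥0 :=
  hittingAfter C.X A 0

open Classical in
/-- The discounted reward `e^{-β η} f(X_η)`, equal to `0` on `{η = ∞}`. -/
noncomputable def discounted (C : FiniteMarkovChain E Ω Q) (β : ℝ) (f : E → ℝ)
    (η : Ω → WithTop ℝ≥0) (ω : Ω) : ℝ :=
  if η ω = ⊤ then 0
  else Real.exp (-β * ((η ω).untopD 0 : ℝ≥0)) * f (C.X ((η ω).untopD 0) ω)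

open Classical in
/-- The expected payoff
`R_x(τ, γ) = E_x[e^{-β τ} ψ(X_τ) 1_{τ ≤ γ} + e^{-β γ} φ(X_γ) 1_{τ > γ}]`. -/
noncomputable def payoff (C : FiniteMarkovChain E Ω Q) (β : ℝ) (ψ φ : E → ℝ) (x : E)
    (τ γ : Ω → WithTop ℝ≥0) : ℝ :=
  ∫ ω, (if τ ω ≤ γ ω then C.discounted β ψ τ ω else C.discounted β φ γ ω) ∂(C.P x)

/-- The one-player optimal stopping value `V₀(x) = sup_τ E_x[e^{-β τ} ψ(X_τ)]`. As in the next two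
definitions, `β > 0` and finiteness of `E` make the extrema those of nonempty bounded sets. -/
noncomputable def stoppingValue (C : FiniteMarkovChain E Ω Q) (β : ℝ) (ψ : E → ℝ) (x : E) : ℝ :=
  ⨆ τ : C.stoppingTimes, ∫ ω, C.discounted β ψ τ ω ∂(C.P x)

/-- The upper value `inf_γ sup_τ R_x(τ, γ)`. -/
noncomputable def upperValue (C : FiniteMarkovChain E Ω Q) (β : ℝ) (ψ φ : E → ℝ) (x : E) : ℝ :=
  ⨅ γ : C.stoppingTimes, ⨆ τ : C.stoppingTimes, C.payoff β ψ φ x τ γ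

/-- The lower value `sup_τ inf_γ R_x(τ, γ)`. -/
noncomputable def lowerValue (C : FiniteMarkovChain E Ω Q) (β : ℝ) (ψ φ : E → ℝ) (x : E) : ℝ :=
  ⨆ τ : C.stoppingTimes, ⨅ γ : C.stoppingTimes, C.payoff β ψ φ x τ γ

/-- The game has a value (lower and upper values agree at every state), and it is `V`. -/
def HasValue (C : FiniteMarkovChain E Ω Q) (β : ℝ) (ψ φ V : E → ℝ) : Prop :=
  ∀ x, C.lowerValue β ψ φ x = V x ∧ C.upperValue β ψ φ x = V x

/-- `(τ', γ')` is a pair of stopping times that is a Nash equilibrium (saddle point), from every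
initial state. -/
def IsNashEquilibrium (C : FiniteMarkovChain E Ω Q) (β : ℝ) (ψ φ : E → ℝ)
    (τ' γ' : Ω → WithTop ℝ≥0) : Prop :=
  τ' ∈ C.stoppingTimes ∧ γ' ∈ C.stoppingTimes ∧
    ∀ x, ∀ τ ∈ C.stoppingTimes, ∀ γ ∈ C.stoppingTimes,
      C.payoff β ψ φ x τ γ' ≤ C.payoff β ψ φ x τ' γ' ∧
        C.payoff β ψ φ x τ' γ' ≤ C.payoff β ψ φ x τ' γ

end FiniteMarkovChain

/-! Let `W` be the least function above `ψ` with `βW - QW ≥ 0`. It solves the obstacle problem: `βW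
- QW` vanishes wherever `W ≠ ψ` (`exists_obstacle_solution`). Hence `e^{-βt} W(X_t)` is a
supermartingale, and has constant expectation when stopped no later than the entrance into `{W =
ψ}`, so `W = V₀` (`stoppingValue_eq`).

By hypothesis `ψ ≤ W ≤ φ`. If the second player uses `γ*`, the payoff is at most the discounted `W`
at `min τ γ*`, since `ψ ≤ W` and `φ = W` at `γ*`; its mean is at most `W x`. If the first player
uses `τ*`, the payoff is at least the discounted `W` at `min τ* γ`, since `ψ = W` at `τ*` and `φ ≥
W`; its mean is exactly `W x`. Saddle point and value follow.

Both facts about `W` come from Dynkin's formula in tail form (`integral_discounted`): with `g = βf -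
Qf`, the mean of `e^{-βσ} f(X_σ)` is that of `∫_σ^∞ e^{-βs} g(X_s) ds`. If `g ≥ 0` the tail is at
most the whole integral; if `g` vanishes along the path before `σ` they agree. The formula needs the
Markov property only at fixed times: random times are reached by grids from above and
right-continuity. -/

open Filter Topology

/-! ### The obstacle problem for `β - Q`. -/

/-- The least `β`-supersolution above an obstacle solves the obstacle problem. -/
theorem IsMarkovGenerator.exists_obstacle_solution {E : Type*} [Fintype E] {Q : Matrix E E ℝ}
    (hQ : IsMarkovGenerator Q) {β : ℝ} (hβ : 0 < β) (ψ : E → ℝ) :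
    ∃ W : E → ℝ, (∀ x, ψ x ≤ W x) ∧ (∀ x, 0 ≤ β * W x - (Q.mulVec W) x) ∧
      ∀ x, W x ≠ ψ x → β * W x - (Q.mulVec W) x = 0 := by
  classical
  have hrow (x : E) (w : E → ℝ) :
      (Q.mulVec w) x = Q x x * w x + ∑ y ∈ Finset.univ.erase x, Q x y * w y := by
    rw [Finset.add_sum_erase _ (fun y => Q x y * w y) (Finset.mem_univ x)]
    rfl
  have hoff (x : E) {v w : E → ℝ} (hvw : ∀ y, v y ≤ w y) :
      ∑ y ∈ Finset.univ.erase x, Q x y * v y ≤ ∑ y ∈ Finset.univ.erase x, Q x y * w y :=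
    Finset.sum_le_sum fun y hy => mul_le_mul_of_nonneg_left (hvw y)
      (hQ.off_diag_nonneg x y (Finset.ne_of_mem_erase hy).symm)
  -- By positivity, the supersolution inequality at `x` bounds `w x` below by a monotone function of
  -- the other coordinates; this is why it survives the infimum.
  have hdiag (x : E) : 0 < β - Q x x := by
    have h := hrow x 1
    have h1 : (Q.mulVec 1) x = 0 := by
      simpa [Matrix.mulVec, dotProduct] using hQ.row_sum_zero x
    have h2 : 0 ≤ ∑ y ∈ Finset.univ.erase x, Q x y * (1 : E → ℝ) y :=
      Finset.sum_nonneg fun y hy => by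
        simpa using hQ.off_diag_nonneg x y (Finset.ne_of_mem_erase hy).symm
    simp only [Pi.one_apply, mul_one] at h h2
    linarith
  set S : Set (E → ℝ) := {w | (∀ x, ψ x ≤ w x) ∧ ∀ x, 0 ≤ β * w x - (Q.mulVec w) x} with hS
  have hne : S.Nonempty := by
    -- `Q` kills constants, so any nonnegative constant above `ψ` will do.
    refine ⟨fun _ => ∑ x, |ψ x|, fun x => ?_, fun x => ?_⟩
    · exact (le_abs_self _).trans
        (Finset.single_le_sum (f := fun x => |ψ x|) (fun y _ => abs_nonneg _) (Finset.mem_univ x))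
    · have : (Q.mulVec fun _ => ∑ x, |ψ x|) x = 0 := by
        simp only [Matrix.mulVec, dotProduct]
        rw [← Finset.sum_mul, hQ.row_sum_zero, zero_mul]
      rw [this, sub_zero]
      positivity
  have : Nonempty S := hne.to_subtype
  have hbdd (x : E) : BddBelow (Set.range fun w : S => w.1 x) :=
    ⟨ψ x, by rintro _ ⟨w, rfl⟩; exact w.2.1 x⟩
  set W : E → ℝ := fun x => ⨅ w : S, w.1 x with hW
  have hWle (w : S) (x : E) : W x ≤ w.1 x := ciInf_le (hbdd x) w
  have hψW (x : E) : ψ x ≤ W x := le_ciInf fun w => w.2.1 x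
  have hsuper (x : E) : 0 ≤ β * W x - (Q.mulVec W) x := by
    have key : (∑ y ∈ Finset.univ.erase x, Q x y * W y) / (β - Q x x) ≤ W x := by
      refine le_ciInf fun w => ?_
      rw [div_le_iff₀ (hdiag x)]
      have h1 := hoff x (hWle w)
      have h2 := w.2.2 x
      rw [hrow] at h2
      linarith
    rw [div_le_iff₀ (hdiag x)] at key
    rw [hrow]
    linarith
  refine ⟨W, hψW, hsuper, fun x hx => ?_⟩
  by_contra hlt
  have hpos := lt_of_le_of_ne (hsuper x) (Ne.symm hlt)
  have hψx := lt_of_le_of_ne (hψW x) (Ne.symm hx)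
  -- The lowest value allowed at `x` by both constraints, the other coordinates being fixed. If
  -- neither is tight, lowering `W x` to `c` contradicts minimality.
  set c := max (ψ x) ((∑ y ∈ Finset.univ.erase x, Q x y * W y) / (β - Q x x)) with hc
  have hcW : c < W x := by
    refine max_lt hψx ?_
    rw [div_lt_iff₀ (hdiag x)]
    rw [hrow] at hpos
    linarith
  have hle (y : E) : Function.update W x c y ≤ W y := by
    by_cases h : y = x
    · subst h; simpa using hcW.le
    · simp [h]
  have hmem : Function.update W x c ∈ S := by
    refine ⟨fun y => ?_, fun y => ?_⟩
    · by_cases h : y = x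
      · subst h; simp [hc]
      · simpa [h] using hψW y
    · rw [hrow]
      have h1 := hoff y hle
      by_cases h : y = x
      · subst h
        have h2 : (∑ z ∈ Finset.univ.erase y, Q y z * W z) / (β - Q y y) ≤ c := le_max_right _ _
        rw [div_le_iff₀ (hdiag y)] at h2
        simp only [Function.update_self]
        linarith
      · have h2 := hsuper y
        rw [hrow] at h2
        simp only [Function.update_of_ne h]
        linarith
  have := hWle ⟨_, hmem⟩ x
  simp only [Function.update_self] at this
  linarith

/-! ### Grids from above, joint measurability, optional stopping. -/

/-- The first point strictly after `s` of the grid of mesh `1 / (n + 1)`. -/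
noncomputable def gridAbove (n : ℕ) (s : ℝ≥0) : ℝ≥0 := (⌊(n + 1 : ℝ≥0) * s⌋₊ + 1) / (n + 1)

theorem lt_gridAbove (n : ℕ) (s : ℝ≥0) : s < gridAbove n s := by
  rw [gridAbove, lt_div_iff₀ (by positivity), mul_comm]
  exact Nat.lt_floor_add_one _

theorem gridAbove_le (n : ℕ) (s : ℝ≥0) : gridAbove n s ≤ s + 1 / (n + 1) := by
  rw [gridAbove, add_div]
  gcongr
  rw [div_le_iff₀ (by positivity), mul_comm]
  exact Nat.floor_le zero_le

theorem tendsto_gridAbove (s : ℝ≥0) : Tendsto (fun n => gridAbove n s) atTop (𝓝[≥] s) := by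
  refine tendsto_nhdsWithin_iff.2 ⟨?_, Eventually.of_forall fun n => (lt_gridAbove n s).le⟩
  refine tendsto_of_tendsto_of_tendsto_of_le_of_le tendsto_const_nhds (h := fun n : ℕ => s + 1 / (n + 1)) ?_
    (fun n => (lt_gridAbove n s).le) (fun n => gridAbove_le n s)
  have h : Tendsto (fun n : ℕ => (1 : ℝ≥0) / (n + 1)) atTop (𝓝 0) :=
    tendsto_one_div_add_atTop_nhds_zero_nat
  simpa using h.const_add s

theorem measurable_floor_mul (n : ℕ) : Measurable fun s : ℝ≥0 => ⌊(n + 1 : ℝ≥0) * s⌋₊ :=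
  Nat.measurable_floor.comp (measurable_const.mul measurable_id)

theorem measurable_gridAbove (n : ℕ) : Measurable (gridAbove n) := by
  have h : Measurable fun k : ℕ => ((k : ℝ≥0) + 1) / (n + 1) := measurable_from_nat
  exact h.comp (measurable_floor_mul n)

/-- A process with right-continuous paths is jointly measurable. -/
theorem measurable_uncurry_of_rightContinuous {Ω E : Type*} [MeasurableSpace Ω]
    [TopologicalSpace E] [TopologicalSpace.PseudoMetrizableSpace E] [MeasurableSpace E]
    [BorelSpace E] {X : ℝ≥0 → Ω → E} (hX : ∀ t, Measurable (X t))
    (hrc : ∀ ω t, ContinuousWithinAt (fun s => X s ω) (Set.Ici t) t) :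
    Measurable (Function.uncurry X) := by
  refine measurable_of_tendsto_metrizable
    (f := fun n (p : ℝ≥0 × Ω) => X (gridAbove n p.1) p.2) (fun n => ?_) ?_
  · have h : Measurable fun q : ℕ × Ω => X (((q.1 : ℝ≥0) + 1) / ((n : ℝ≥0) + 1)) q.2 :=
      measurable_from_prod_countable_right fun k => hX (((k : ℝ≥0) + 1) / ((n : ℝ≥0) + 1))
    have h' : Measurable fun p : ℝ≥0 × Ω => (⌊(n + 1 : ℝ≥0) * p.1⌋₊, p.2) :=
      ((measurable_floor_mul n).comp measurable_fst).prodMk measurable_snd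
    simpa only [gridAbove, Function.comp_def] using h.comp h'
  · rw [tendsto_pi_nhds]
    rintro ⟨t, ω⟩
    exact (hrc ω t).tendsto.comp (tendsto_gridAbove t)

theorem MeasureTheory.IsStoppingTime.measurable_untopD {Ω : Type*} {m : MeasurableSpace Ω}
    {𝓕 : Filtration ℝ≥0 m} {σ : Ω → WithTop ℝ≥0} (hσ : IsStoppingTime 𝓕 σ) :
    Measurable fun ω => (σ ω).untopD 0 :=
  hσ.measurable'.untopD 0

theorem MeasureTheory.IsStoppingTime.measurableSet_ne_top {Ω : Type*} {m : MeasurableSpace Ω}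
    {𝓕 : Filtration ℝ≥0 m} {σ : Ω → WithTop ℝ≥0} (hσ : IsStoppingTime 𝓕 σ) :
    MeasurableSet {ω | σ ω ≠ ⊤} :=
  hσ.measurableSet_eq_top.compl

/-- Optional stopping for a bounded right-continuous process whose integral at time `t` vanishes
on every event of the past of `t`. -/
theorem MeasureTheory.IsStoppingTime.setIntegral_eq_zero {Ω : Type*} {m : MeasurableSpace Ω}
    {𝓕 : Filtration ℝ≥0 m} {μ : Measure Ω} [IsFiniteMeasure μ] {D : ℝ≥0 → Ω → ℝ} {B : ℝ}
    (hD : Measurable (Function.uncurry D)) (hB : ∀ t ω, |D t ω| ≤ B)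
    (hrc : ∀ ω t, ContinuousWithinAt (fun s => D s ω) (Set.Ici t) t)
    (h0 : ∀ t A, MeasurableSet[𝓕 t] A → ∫ ω in A, D t ω ∂μ = 0)
    {σ : Ω → WithTop ℝ≥0} (hσ : IsStoppingTime 𝓕 σ) :
    ∫ ω in {ω | σ ω ≠ ⊤}, D ((σ ω).untopD 0) ω ∂μ = 0 := by
  have hmeas (n : ℕ) : Measurable fun ω => D (gridAbove n ((σ ω).untopD 0)) ω :=
    hD.comp (((measurable_gridAbove n).comp hσ.measurable_untopD).prodMk measurable_id)
  have hgrid (n : ℕ) :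
      ∫ ω in {ω | σ ω ≠ ⊤}, D (gridAbove n ((σ ω).untopD 0)) ω ∂μ = 0 := by
    -- On `A k` the grid time is the constant `(k + 1) / (n + 1)`, and `A k` is an event of the past
    -- of that time, so `h0` applies piece by piece.
    set A : ℕ → Set Ω := fun k =>
      {ω | σ ω < ((k + 1 : ℝ≥0) / (n + 1) : ℝ≥0)} \ {ω | σ ω < ((k : ℝ≥0) / (n + 1) : ℝ≥0)} with hA
    have hn : (0 : ℝ≥0) < n + 1 := by positivity
    have hAmem (k : ℕ) (ω : Ω) :
        ω ∈ A k ↔ σ ω ≠ ⊤ ∧ ⌊(n + 1 : ℝ≥0) * (σ ω).untopD 0⌋₊ = k := by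
      cases h : σ ω with
      | top => simp only [hA, Set.mem_sdiff, Set.mem_ofPred_eq, h, not_top_lt, false_and, ne_eq,
          not_true_eq_false]
      | coe s =>
        simp only [hA, Set.mem_sdiff, Set.mem_ofPred_eq, h, WithTop.coe_lt_coe, not_lt,
          WithTop.untopD_coe, ne_eq, WithTop.coe_ne_top, not_false_eq_true, true_and]
        rw [Nat.floor_eq_iff zero_le, lt_div_iff₀ hn, div_le_iff₀ hn, mul_comm, and_comm]
    have hAF (k : ℕ) : MeasurableSet[𝓕 ((k + 1 : ℝ≥0) / (n + 1))] (A k) := by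
      refine (hσ.measurableSet_lt _).diff (𝓕.mono ?_ _ (hσ.measurableSet_lt _))
      gcongr
      simp
    have hU : {ω | σ ω ≠ ⊤} = ⋃ k, A k := by
      ext ω
      simp only [Set.mem_iUnion, hAmem, Set.mem_ofPred_eq]
      exact ⟨fun h => ⟨_, h, rfl⟩, fun ⟨_, h, _⟩ => h⟩
    have hsum := hasSum_integral_iUnion (μ := μ)
      (f := fun ω => D (gridAbove n ((σ ω).untopD 0)) ω)
      (fun k => 𝓕.le _ _ (hAF k)) (fun i j hij => Set.disjoint_left.2 fun ω hi hj =>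
        hij (((hAmem i ω).1 hi).2.symm.trans ((hAmem j ω).1 hj).2))
      (Integrable.of_bound (hmeas n).aestronglyMeasurable B
        (Eventually.of_forall fun ω => hB _ _))
    have hz (k : ℕ) : ∫ ω in A k, D (gridAbove n ((σ ω).untopD 0)) ω ∂μ = 0 := by
      rw [← h0 _ _ (hAF k)]
      refine setIntegral_congr_fun (𝓕.le _ _ (hAF k)) fun ω hω => ?_
      simp only [gridAbove, ((hAmem k ω).1 hω).2]
    simp only [hz] at hsum
    rw [hU]
    exact hsum.unique hasSum_zero
  have hlim := tendsto_integral_of_dominated_convergence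
    (μ := μ.restrict {ω | σ ω ≠ ⊤}) (F := fun n ω => D (gridAbove n ((σ ω).untopD 0)) ω)
    (f := fun ω => D ((σ ω).untopD 0) ω) (fun _ => B) (fun n => (hmeas n).aestronglyMeasurable)
    (integrable_const B) (fun n => Eventually.of_forall fun ω => hB _ _)
    (Eventually.of_forall fun ω => (hrc ω _).tendsto.comp (tendsto_gridAbove _))
  simp only [hgrid] at hlim
  exact tendsto_nhds_unique hlim tendsto_const_nhds

theorem abs_le_sum_abs {E : Type*} [Fintype E] (f : E → ℝ) (x : E) : |f x| ≤ ∑ z, |f z| :=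
  Finset.single_le_sum (f := fun z => |f z|) (fun _ _ => abs_nonneg _) (Finset.mem_univ x)

/-! ### Measurability and entrance times of the chain. -/

namespace FiniteMarkovChain

variable {E Ω : Type*} [Fintype E] [TopologicalSpace E] [DiscreteTopology E]
  [MeasurableSpace E] [BorelSpace E] [MeasurableSpace Ω] {Q : Matrix E E ℝ}

instance (C : FiniteMarkovChain E Ω Q) (x : E) : IsProbabilityMeasure (C.P x) :=
  C.isProbabilityMeasure x

theorem measurable_uncurry (C : FiniteMarkovChain E Ω Q) : Measurable (Function.uncurry C.X) :=
  measurable_uncurry_of_rightContinuous C.measurable C.right_continuous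

theorem measurable_comp (C : FiniteMarkovChain E Ω Q) (f : E → ℝ) (t : ℝ≥0) :
    Measurable fun ω => f (C.X t ω) :=
  (measurable_of_finite f).comp (C.measurable t)

theorem integrable_comp (C : FiniteMarkovChain E Ω Q) (f : E → ℝ) (t : ℝ≥0) (x : E) :
    Integrable (fun ω => f (C.X t ω)) (C.P x) :=
  Integrable.of_bound (C.measurable_comp f t).aestronglyMeasurable (∑ z, |f z|)
    (Eventually.of_forall fun _ => abs_le_sum_abs f _)

/-- In a discrete space a right-continuous path is constant just after each time, so the infimum of
the visiting times is attained. -/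
theorem hit_le_coe_iff (C : FiniteMarkovChain E Ω Q) {A : Set E} {ω : Ω} {t : ℝ≥0} :
    C.hit A ω ≤ t ↔ ∃ s ≤ t, C.X s ω ∈ A := by
  rw [hit, hittingAfter]
  split_ifs with h
  · set S := {i : ℝ≥0 | 0 ≤ i ∧ C.X i ω ∈ A}
    have hS : S.Nonempty := h
    have hmem : C.X (sInf S) ω ∈ A := by
      have hnear : ∀ᶠ i in 𝓝[≥] sInf S, C.X i ω = C.X (sInf S) ω :=
        (C.right_continuous ω (sInf S)).preimage_mem_nhdsWithin
          ((isOpen_discrete {C.X (sInf S) ω}).mem_nhds rfl)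
      have hfreq : ∃ᶠ i in 𝓝[≥] sInf S, i ∈ S :=
        (isGLB_csInf hS (OrderBot.bddBelow S)).frequently_mem hS
      obtain ⟨i, hi, hi'⟩ := (hfreq.and_eventually hnear).exists
      exact hi' ▸ hi.2
    rw [WithTop.coe_le_coe]
    exact ⟨fun hst => ⟨_, hst, hmem⟩,
      fun ⟨s, hs, hsA⟩ => (csInf_le (OrderBot.bddBelow S) (show s ∈ S from ⟨zero_le, hsA⟩)).trans hs⟩
  · simp only [top_le_iff, WithTop.coe_ne_top, false_iff, not_exists, not_and]
    exact fun s _ hs => h ⟨s, zero_le, hs⟩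

theorem mem_of_hit_eq_coe (C : FiniteMarkovChain E Ω Q) {A : Set E} {ω : Ω} {t : ℝ≥0}
    (h : C.hit A ω = t) : C.X t ω ∈ A := by
  obtain ⟨s, hst, hs⟩ := C.hit_le_coe_iff.1 h.le
  have := C.hit_le_coe_iff.2 ⟨s, le_rfl, hs⟩
  rw [h, WithTop.coe_le_coe] at this
  rwa [le_antisymm this hst]

theorem notMem_of_lt_hit (C : FiniteMarkovChain E Ω Q) {A : Set E} {ω : Ω} {t : ℝ≥0}
    (h : (t : WithTop ℝ≥0) < C.hit A ω) : C.X t ω ∉ A :=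
  fun hA => h.not_ge (C.hit_le_coe_iff.2 ⟨t, le_rfl, hA⟩)

/-- The first entrance times of a right-continuous chain are stopping times of the natural
filtration. -/
theorem isStoppingTime_hit (C : FiniteMarkovChain E Ω Q) (A : Set E) :
    IsStoppingTime C.filtration (C.hit A) := by
  have hX {s t : ℝ≥0} (hst : s ≤ t) : MeasurableSet[C.filtration t] {ω | C.X s ω ∈ A} :=
    le_iSup₂_of_le (f := fun j (_ : j ≤ t) => MeasurableSpace.comap (C.X j) _) s hst le_rfl _
      ⟨A, (Set.toFinite A).measurableSet, rfl⟩
  intro t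
  -- A visit before `t` lasts long enough to contain a rational time up to `t`; a visit at `t`
  -- itself may not, hence the separate term.
  have : {ω | C.hit A ω ≤ t} = {ω | C.X t ω ∈ A} ∪
      ⋃ (q : ℚ) (_ : (q : ℝ).toNNReal ≤ t), {ω | C.X (q : ℝ).toNNReal ω ∈ A} := by
    ext ω
    simp only [Set.mem_ofPred_eq, Set.mem_union, Set.mem_iUnion, exists_prop, hit_le_coe_iff]
    refine ⟨fun ⟨s, hs, hsA⟩ => ?_, ?_⟩
    · rcases hs.eq_or_lt with rfl | hlt
      · exact Or.inl hsA
      · right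
        have hnear : ∀ᶠ u in 𝓝[≥] s, C.X u ω = C.X s ω :=
          (C.right_continuous ω s).preimage_mem_nhdsWithin
            ((isOpen_discrete {C.X s ω}).mem_nhds rfl)
        obtain ⟨v, hv, hv'⟩ := (mem_nhdsGE_iff_exists_Ico_subset' hlt).1 hnear
        have hsv : s < min v t := lt_min hv hlt
        obtain ⟨q, hq1, hq2⟩ := exists_rat_btwn (NNReal.coe_lt_coe.2 hsv)
        have h1 : s < (q : ℝ).toNNReal := Real.lt_toNNReal_iff_coe_lt.2 hq1
        have h2 : (q : ℝ).toNNReal < min v t :=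
          (Real.toNNReal_lt_iff_lt_coe (s.2.trans hq1.le)).2 hq2
        refine ⟨q, h2.le.trans (min_le_right _ _), ?_⟩
        have : C.X (q : ℝ).toNNReal ω = C.X s ω := hv' ⟨h1.le, h2.trans_le (min_le_left _ _)⟩
        rwa [this]
    · rintro (h | ⟨q, hq, h⟩)
      exacts [⟨t, le_rfl, h⟩, ⟨_, hq, h⟩]
  rw [this]
  exact (hX le_rfl).union (MeasurableSet.iUnion fun q => MeasurableSet.iUnion fun hq => hX hq)

/-! ### Transition semigroup and resolvent. -/

/-- The transition semigroup `f ↦ E_x[f(X_t)]`. -/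
noncomputable def transition (C : FiniteMarkovChain E Ω Q) (t : ℝ≥0) (f : E → ℝ) (x : E) : ℝ :=
  ∫ ω, f (C.X t ω) ∂(C.P x)

theorem comp_eq_sum (C : FiniteMarkovChain E Ω Q) (t : ℝ≥0) (f : E → ℝ) (ω : Ω) :
    f (C.X t ω) = ∑ y, (C.X t ⁻¹' {y}).indicator (fun _ => (1 : ℝ)) ω * f y := by
  classical
  rw [Finset.sum_eq_single (C.X t ω)]
  · simp
  · intro y _ hy
    simp [Ne.symm hy]
  · simp

theorem integrable_indicator (C : FiniteMarkovChain E Ω Q) (t : ℝ≥0) (x y : E) :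
    Integrable ((C.X t ⁻¹' {y}).indicator (fun _ => (1 : ℝ))) (C.P x) :=
  (integrable_const 1).indicator (C.measurable t (measurableSet_singleton y))

theorem transition_eq_sum (C : FiniteMarkovChain E Ω Q) (t : ℝ≥0) (f : E → ℝ) (x : E) :
    C.transition t f x = ∑ y, (C.P x).real (C.X t ⁻¹' {y}) * f y := by
  simp only [transition, C.comp_eq_sum t f]
  rw [integral_finsetSum _ fun y _ => (C.integrable_indicator t x y).mul_const _]
  refine Finset.sum_congr rfl fun y _ => ?_
  rw [integral_mul_const, integral_indicator_const _ (C.measurable t (measurableSet_singleton y))]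
  simp

/-- The Markov property, integrated over an event of the past. -/
theorem setIntegral_comp_add (C : FiniteMarkovChain E Ω Q) (s t : ℝ≥0) (f : E → ℝ) (x : E)
    {A : Set Ω} (hA : MeasurableSet[C.filtration s] A) :
    ∫ ω in A, f (C.X (s + t) ω) ∂(C.P x) = ∫ ω in A, C.transition t f (C.X s ω) ∂(C.P x) := by
  simp only [C.comp_eq_sum (s + t) f, transition_eq_sum]
  rw [integral_finsetSum _ fun y _ => ((C.integrable_indicator _ x y).mul_const _).integrableOn,
    integral_finsetSum _ fun y _ => (C.integrable_comp
      (fun z => (C.P z).real (C.X t ⁻¹' {y}) * f y) s x).integrableOn]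
  refine Finset.sum_congr rfl fun y _ => ?_
  rw [integral_mul_const, integral_mul_const,
    ← setIntegral_condExp (C.filtration.le s) (C.integrable_indicator (s + t) x y) hA]
  congr 1
  exact integral_congr_ae (ae_restrict_of_ae (C.markov x s t y))

theorem transition_add (C : FiniteMarkovChain E Ω Q) (s t : ℝ≥0) (f : E → ℝ) (x : E) :
    C.transition (s + t) f x = C.transition s (C.transition t f) x := by
  simpa [transition] using C.setIntegral_comp_add s t f x MeasurableSet.univ

theorem transition_sub (C : FiniteMarkovChain E Ω Q) (t : ℝ≥0) (f g : E → ℝ) (x : E) :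
    C.transition t (f - g) x = C.transition t f x - C.transition t g x :=
  integral_sub (C.integrable_comp f t x) (C.integrable_comp g t x)

theorem ae_start (C : FiniteMarkovChain E Ω Q) (x : E) : ∀ᵐ ω ∂(C.P x), C.X 0 ω = x :=
  (prob_compl_eq_zero_iff (C.measurable 0 (measurableSet_singleton x))).2 (C.start x)

theorem transition_zero (C : FiniteMarkovChain E Ω Q) (f : E → ℝ) : C.transition 0 f = f := by
  ext x
  have : (fun ω => f (C.X 0 ω)) =ᵐ[C.P x] fun _ => f x :=
    (C.ae_start x).mono fun ω h => by simp only [h]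
  rw [transition, integral_congr_ae this]
  simp

theorem abs_transition_le (C : FiniteMarkovChain E Ω Q) (t : ℝ≥0) (f : E → ℝ) (x : E) :
    |C.transition t f x| ≤ ∑ z, |f z| := by
  have := norm_integral_le_of_norm_le_const (μ := C.P x)
    (f := fun ω => f (C.X t ω)) (Eventually.of_forall fun ω => abs_le_sum_abs f (C.X t ω))
  simpa [transition] using this

theorem hasDerivWithinAt_transition_zero (C : FiniteMarkovChain E Ω Q) (f : E → ℝ) (x : E) :
    HasDerivWithinAt (fun t : ℝ => C.transition t.toNNReal f x) (Q.mulVec f x) (Set.Ici 0) 0 := by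
  simp only [transition_eq_sum]
  exact HasDerivWithinAt.fun_sum fun y _ => (C.generator x y).mul_const _

/-- The factorization `P_t = P_s P_{t-s}` carries the right derivative at zero to `s`. -/
theorem hasDerivWithinAt_transition (C : FiniteMarkovChain E Ω Q) (f : E → ℝ) (x : E) {s : ℝ}
    (hs : 0 ≤ s) :
    HasDerivWithinAt (fun t : ℝ => C.transition t.toNNReal f x)
      (C.transition s.toNNReal (Q.mulVec f) x) (Set.Ici s) s := by
  have h (y : E) : HasDerivWithinAt (fun t : ℝ => C.transition (t - s).toNNReal f y)
      (Q.mulVec f y) (Set.Ici s) s := by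
    have h1 : HasDerivWithinAt (fun t : ℝ => t - s) 1 (Set.Ici s) s :=
      ((hasDerivAt_id s).sub_const s).hasDerivWithinAt
    have h2 : HasDerivWithinAt (fun t : ℝ => C.transition t.toNNReal f y) (Q.mulVec f y)
        (Set.Ici 0) (s - s) := by
      simpa using C.hasDerivWithinAt_transition_zero f y
    simpa [Function.comp_def] using h2.comp (h := fun t => t - s) s h1
      fun t ht => Set.mem_Ici.2 (sub_nonneg.2 ht)
  have h' : HasDerivWithinAt (fun t : ℝ => C.transition s.toNNReal
      (C.transition (t - s).toNNReal f) x)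
      (C.transition s.toNNReal (Q.mulVec f) x) (Set.Ici s) s := by
    simp only [C.transition_eq_sum s.toNNReal]
    exact HasDerivWithinAt.fun_sum fun y _ => (h y).const_mul _
  refine h'.congr_of_mem (fun t ht => ?_) Set.self_mem_Ici
  rw [← transition_add, ← Real.toNNReal_add hs (sub_nonneg.2 ht), add_sub_cancel]

/-- Right derivatives say nothing about left limits. Here `|P_t f - P_s f| ≤ ∑ |P_{t-s} f - f|`
treats both sides at once. -/
theorem continuous_transition (C : FiniteMarkovChain E Ω Q) (f : E → ℝ) (x : E) :
    Continuous fun t : ℝ => C.transition t.toNNReal f x := by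
  have hz (z : E) : Tendsto (fun u : ℝ => |C.transition u.toNNReal f z - f z|) (𝓝[≥] 0) (𝓝 0) := by
    have := (C.hasDerivWithinAt_transition_zero f z).continuousWithinAt.tendsto
    simpa [transition_zero] using (this.sub_const (f z)).abs
  have hsum : Tendsto (fun u : ℝ => ∑ z, |C.transition u.toNNReal f z - f z|) (𝓝[≥] 0) (𝓝 0) := by
    simpa using tendsto_finsetSum Finset.univ fun z _ => hz z
  have hbound {s t : ℝ≥0} (hst : s ≤ t) : |C.transition t f x - C.transition s f x| ≤
      ∑ z, |C.transition (t - s) f z - f z| := by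
    have : C.transition t f x - C.transition s f x =
        C.transition s (C.transition (t - s) f - f) x := by
      rw [transition_sub, ← transition_add, add_tsub_cancel_of_le hst]
    rw [this]
    exact C.abs_transition_le _ _ _
  have hcont : Continuous fun t : ℝ≥0 => C.transition t f x := by
    rw [continuous_iff_continuousAt]
    intro s
    rw [ContinuousAt, tendsto_iff_dist_tendsto_zero]
    have hd : Tendsto (fun t : ℝ≥0 => dist t s) (𝓝 s) (𝓝[≥] 0) := by
      refine tendsto_nhdsWithin_iff.2 ⟨?_, Eventually.of_forall fun t => dist_nonneg⟩
      simpa using (continuous_id.dist (continuous_const (y := s))).tendsto s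
    refine squeeze_zero (fun _ => dist_nonneg) (fun t => ?_) (hsum.comp hd)
    rcases le_total s t with hst | hst
    · have h : (dist t s).toNNReal = t - s := by
        rw [NNReal.dist_eq, ← NNReal.coe_sub hst, NNReal.abs_eq, Real.toNNReal_coe]
      simpa only [Function.comp_def, h, Real.dist_eq] using hbound hst
    · have h : (dist t s).toNNReal = s - t := by
        rw [dist_comm, NNReal.dist_eq, ← NNReal.coe_sub hst, NNReal.abs_eq, Real.toNNReal_coe]
      rw [dist_comm]
      simpa only [Function.comp_def, h, Real.dist_eq] using hbound hst
  exact hcont.comp continuous_real_toNNReal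

theorem integrableOn_exp_mul (β : ℝ) (hβ : 0 < β) {g : ℝ → ℝ} (hg : Measurable g) {B : ℝ}
    (hB : ∀ u, |g u| ≤ B) : IntegrableOn (fun u => Real.exp (-β * u) * g u) (Set.Ioi 0) :=
  (exp_neg_integrableOn_Ioi 0 hβ).mul_bdd hg.aestronglyMeasurable (Eventually.of_forall hB)

/-- The resolvent of the chain inverts `β - Q`. -/
theorem integral_exp_mul_transition (C : FiniteMarkovChain E Ω Q) {β : ℝ} (hβ : 0 < β)
    (f : E → ℝ) (x : E) :
    ∫ u in Set.Ioi (0 : ℝ), Real.exp (-β * u) *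
      C.transition u.toNNReal (β • f - Q.mulVec f) x = f x := by
  set k : ℝ → ℝ := fun u => Real.exp (-β * u) * C.transition u.toNNReal (β • f - Q.mulVec f) x
  have hkc : Continuous k := by
    have := C.continuous_transition (β • f - Q.mulVec f) x
    fun_prop
  have hki : IntegrableOn k (Set.Ioi 0) :=
    integrableOn_exp_mul β hβ (C.continuous_transition _ x).measurable
      fun u => C.abs_transition_le _ _ _
  -- Since the right derivative of `P_u f` is `P_u (Q f)`, the integrand `k` is an exact derivative.
  have hderiv (s : ℝ) (hs : 0 ≤ s) :
      HasDerivWithinAt (fun u : ℝ => -(Real.exp (-β * u) * C.transition u.toNNReal f x)) (k s)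
        (Set.Ioi s) s := by
    have h1 : HasDerivWithinAt (fun u : ℝ => Real.exp (-β * u)) (Real.exp (-β * s) * (-β))
        (Set.Ici s) s := by
      simpa using (((hasDerivAt_id s).const_mul (-β)).exp).hasDerivWithinAt
    have h2 := (h1.mul (C.hasDerivWithinAt_transition f x hs)).neg.mono Set.Ioi_subset_Ici_self
    refine h2.congr_deriv ?_
    have : C.transition s.toNNReal (β • f) x = β * C.transition s.toNNReal f x := by
      simp [transition, integral_const_mul]
    simp only [k, transition_sub, this]
    ring
  have hFTC (b : ℝ) (hb : 0 ≤ b) :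
      ∫ u in (0 : ℝ)..b, k u = f x - Real.exp (-β * b) * C.transition b.toNNReal f x := by
    rw [intervalIntegral.integral_eq_sub_of_hasDeriv_right
      (f := fun u : ℝ => -(Real.exp (-β * u) * C.transition u.toNNReal f x)) (f' := k)]
    · simp [transition_zero]
      ring
    · have := C.continuous_transition f x
      exact Continuous.continuousOn (by fun_prop)
    · intro s hs
      rw [min_eq_left hb] at hs
      exact hderiv s hs.1.le
    · exact hkc.intervalIntegrable _ _
  have hlim := intervalIntegral_tendsto_integral_Ioi 0 hki tendsto_id
  have hexp : Tendsto (fun b : ℝ => Real.exp (-β * b)) atTop (𝓝 0) :=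
    Real.tendsto_exp_atBot.comp (tendsto_id.const_mul_atTop_of_neg (neg_lt_zero.2 hβ))
  have hzero : Tendsto (fun b : ℝ => Real.exp (-β * b) * C.transition b.toNNReal f x) atTop (𝓝 0) := by
    refine squeeze_zero_norm (a := fun b => Real.exp (-β * b) * ∑ z, |f z|) (fun b => ?_) ?_
    · rw [norm_mul, Real.norm_eq_abs, Real.abs_exp]
      gcongr
      exact C.abs_transition_le _ _ _
    · simpa using hexp.mul_const (∑ z, |f z|)
  refine tendsto_nhds_unique hlim ?_
  have : Tendsto (fun b : ℝ => f x - Real.exp (-β * b) * C.transition b.toNNReal f x) atTop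
      (𝓝 (f x)) := by
    simpa using hzero.const_sub (f x)
  refine this.congr' ?_
  filter_upwards [eventually_ge_atTop 0] with b hb
  rw [← hFTC b hb, id]

/-! ### Future rewards and Dynkin's formula. -/

/-- The discounted reward accumulated at rate `g` after time `t`, seen from time `t`. -/
noncomputable def futureReward (C : FiniteMarkovChain E Ω Q) (β : ℝ) (g : E → ℝ) (t : ℝ≥0)
    (ω : Ω) : ℝ :=
  ∫ u in Set.Ioi (0 : ℝ), Real.exp (-β * u) * g (C.X (t + u.toNNReal) ω)

theorem measurable_comp_add (C : FiniteMarkovChain E Ω Q) (g : E → ℝ) :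
    Measurable fun p : (ℝ≥0 × Ω) × ℝ => g (C.X (p.1.1 + p.2.toNNReal) p.1.2) := by
  have h : Measurable fun p : (ℝ≥0 × Ω) × ℝ => (p.1.1 + p.2.toNNReal, p.1.2) := by fun_prop
  exact (measurable_of_finite g).comp (C.measurable_uncurry.comp h)

theorem measurable_futureReward (C : FiniteMarkovChain E Ω Q) (β : ℝ) (g : E → ℝ) :
    Measurable (Function.uncurry (C.futureReward β g)) := by
  refine (StronglyMeasurable.integral_prod_right (ν := volume.restrict (Set.Ioi (0 : ℝ)))
    (f := fun (p : ℝ≥0 × Ω) u => Real.exp (-β * u) * g (C.X (p.1 + u.toNNReal) p.2))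
    (Measurable.stronglyMeasurable ?_)).measurable
  exact (Real.measurable_exp.comp (measurable_snd.const_mul _)).mul (C.measurable_comp_add g)

theorem abs_futureReward_le (C : FiniteMarkovChain E Ω Q) {β : ℝ} (hβ : 0 < β) (g : E → ℝ)
    (t : ℝ≥0) (ω : Ω) : |C.futureReward β g t ω| ≤
      ∫ u in Set.Ioi (0 : ℝ), Real.exp (-β * u) * ∑ z, |g z| := by
  rw [futureReward, ← Real.norm_eq_abs]
  refine norm_integral_le_of_norm_le ((exp_neg_integrableOn_Ioi 0 hβ).mul_const _)
    (Eventually.of_forall fun u => ?_)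
  rw [norm_mul, Real.norm_eq_abs, Real.abs_exp]
  gcongr
  exact abs_le_sum_abs g _

theorem integrable_futureReward (C : FiniteMarkovChain E Ω Q) {β : ℝ} (hβ : 0 < β) (g : E → ℝ)
    (t : ℝ≥0) (x : E) : Integrable (C.futureReward β g t) (C.P x) :=
  Integrable.of_bound ((C.measurable_futureReward β g).comp
    (measurable_const.prodMk measurable_id : Measurable fun ω => (t, ω))).aestronglyMeasurable
    _ (Eventually.of_forall (C.abs_futureReward_le hβ g t))

theorem continuousWithinAt_comp (C : FiniteMarkovChain E Ω Q) (g : E → ℝ) (ω : Ω) (t : ℝ≥0) :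
    ContinuousWithinAt (fun s => g (C.X s ω)) (Set.Ici t) t :=
  (continuous_of_discreteTopology (f := g)).continuousAt.comp_continuousWithinAt
    (C.right_continuous ω t)

theorem continuousWithinAt_futureReward (C : FiniteMarkovChain E Ω Q) {β : ℝ} (hβ : 0 < β)
    (g : E → ℝ) (ω : Ω) (t : ℝ≥0) :
    ContinuousWithinAt (fun s => C.futureReward β g s ω) (Set.Ici t) t := by
  refine continuousWithinAt_of_dominated (bound := fun u => Real.exp (-β * u) * ∑ z, |g z|)
    (Eventually.of_forall fun s => ?_) (Eventually.of_forall fun s => Eventually.of_forall fun u => ?_)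
    ((exp_neg_integrableOn_Ioi 0 hβ).mul_const _) (Eventually.of_forall fun u => ?_)
  · exact (Measurable.mul (by fun_prop) ((C.measurable_comp_add g).comp
      (measurable_const.prodMk measurable_id : Measurable fun u : ℝ => ((s, ω), u)))).aestronglyMeasurable
  · rw [norm_mul, Real.norm_eq_abs, Real.abs_exp]
    gcongr
    exact abs_le_sum_abs g _
  · refine ContinuousWithinAt.const_mul ?_ _
    refine (C.continuousWithinAt_comp g ω (t + u.toNNReal)).comp
      (f := fun s => s + u.toNNReal) (Continuous.continuousWithinAt (by fun_prop)) ?_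
    intro s hs
    exact add_le_add_left (Set.mem_Ici.1 hs) _

/-- Fubini, the Markov property at `t` and the resolvent identity: `f(X_t)` is the conditional mean
of the future reward given the past of `t`. -/
theorem setIntegral_futureReward (C : FiniteMarkovChain E Ω Q) {β : ℝ} (hβ : 0 < β) (f : E → ℝ)
    (x : E) (t : ℝ≥0) {A : Set Ω} (hA : MeasurableSet[C.filtration t] A) :
    ∫ ω in A, C.futureReward β (β • f - Q.mulVec f) t ω ∂(C.P x) =
      ∫ ω in A, f (C.X t ω) ∂(C.P x) := by
  set g := β • f - Q.mulVec f with hg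
  have hint (k : Ω → ℝ → ℝ) (hk : Measurable (Function.uncurry k))
      (hb : ∀ ω u, |k ω u| ≤ ∑ z, |g z|) :
      Integrable (Function.uncurry fun ω u => Real.exp (-β * u) * k ω u)
        (((C.P x).restrict A).prod (volume.restrict (Set.Ioi (0 : ℝ)))) := by
    have h1 : Integrable (fun p : Ω × ℝ => Real.exp (-β * p.2))
        (((C.P x).restrict A).prod (volume.restrict (Set.Ioi (0 : ℝ)))) :=
      Integrable.comp_snd (f := fun u : ℝ => Real.exp (-β * u)) (exp_neg_integrableOn_Ioi 0 hβ) _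
    exact h1.mul_bdd hk.aestronglyMeasurable (Eventually.of_forall fun p => hb p.1 p.2)
  have hk1 : Measurable (Function.uncurry fun ω (u : ℝ) => g (C.X (t + u.toNNReal) ω)) := by
    have h : Measurable fun p : Ω × ℝ => ((t, p.1), p.2) := by fun_prop
    exact (C.measurable_comp_add g).comp h
  have hk2 : Measurable
      (Function.uncurry fun ω (u : ℝ) => C.transition u.toNNReal g (C.X t ω)) := by
    have h : Measurable fun p : E × ℝ => C.transition p.2.toNNReal g p.1 :=
      measurable_from_prod_countable_right fun z => (C.continuous_transition g z).measurable
    have h' : Measurable fun p : Ω × ℝ => (C.X t p.1, p.2) :=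
      ((C.measurable t).comp measurable_fst).prodMk measurable_snd
    exact h.comp h'
  simp only [futureReward]
  rw [integral_integral_swap (hint _ hk1 fun ω u => abs_le_sum_abs g _)]
  have : ∀ u : ℝ, ∫ ω in A, Real.exp (-β * u) * g (C.X (t + u.toNNReal) ω) ∂(C.P x) =
      ∫ ω in A, Real.exp (-β * u) * C.transition u.toNNReal g (C.X t ω) ∂(C.P x) := fun u => by
    rw [integral_const_mul, integral_const_mul, C.setIntegral_comp_add t _ g x hA]
  simp only [this]
  rw [← integral_integral_swap (hint _ hk2 fun ω u => C.abs_transition_le _ _ _)]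
  simp only [hg, C.integral_exp_mul_transition hβ]

theorem discounted_eq (C : FiniteMarkovChain E Ω Q) (β : ℝ) (f : E → ℝ) (σ : Ω → WithTop ℝ≥0) :
    C.discounted β f σ = {ω | σ ω ≠ ⊤}.indicator
      fun ω => Real.exp (-β * ((σ ω).untopD 0 : ℝ≥0)) * f (C.X ((σ ω).untopD 0) ω) := by
  classical
  ext ω
  by_cases h : σ ω = ⊤ <;> simp [discounted, h]

theorem measurable_discounted (C : FiniteMarkovChain E Ω Q) (β : ℝ) (f : E → ℝ)
    {σ : Ω → WithTop ℝ≥0} (hσ : IsStoppingTime C.filtration σ) :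
    Measurable (C.discounted β f σ) := by
  rw [discounted_eq]
  have h1 := hσ.measurable_untopD
  have h2 : Measurable fun ω => f (C.X ((σ ω).untopD 0) ω) :=
    (measurable_of_finite f).comp (C.measurable_uncurry.comp (h1.prodMk measurable_id))
  refine Measurable.indicator (Measurable.mul ?_ h2) hσ.measurableSet_ne_top
  exact Real.measurable_exp.comp (h1.coe_nnreal_real.const_mul _)

theorem exp_neg_mul_le_one {β : ℝ} (hβ : 0 < β) (t : ℝ≥0) : Real.exp (-β * t) ≤ 1 :=
  Real.exp_le_one_iff.2 (mul_nonpos_of_nonpos_of_nonneg (neg_nonpos.2 hβ.le) t.2)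

theorem abs_discounted_le (C : FiniteMarkovChain E Ω Q) {β : ℝ} (hβ : 0 < β) (f : E → ℝ)
    (σ : Ω → WithTop ℝ≥0) (ω : Ω) : |C.discounted β f σ ω| ≤ ∑ z, |f z| := by
  classical
  rw [discounted]
  split_ifs
  · simpa using Finset.sum_nonneg fun z _ => abs_nonneg (f z)
  · rw [abs_mul, Real.abs_exp, ← one_mul (∑ z, |f z|)]
    gcongr
    exacts [exp_neg_mul_le_one hβ _, abs_le_sum_abs f _]

theorem integrable_discounted (C : FiniteMarkovChain E Ω Q) {β : ℝ} (hβ : 0 < β) (f : E → ℝ)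
    {σ : Ω → WithTop ℝ≥0} (hσ : IsStoppingTime C.filtration σ) (x : E) :
    Integrable (C.discounted β f σ) (C.P x) :=
  Integrable.of_bound (C.measurable_discounted β f hσ).aestronglyMeasurable _
    (Eventually.of_forall (C.abs_discounted_le hβ f σ))

/-- Dynkin's formula: the discounted value of `f` at a stopping time is the expected reward
accumulated afterwards at rate `(β - Q) f`. -/
theorem integral_discounted (C : FiniteMarkovChain E Ω Q) {β : ℝ} (hβ : 0 < β) (f : E → ℝ)
    {σ : Ω → WithTop ℝ≥0} (hσ : IsStoppingTime C.filtration σ) (x : E) :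
    ∫ ω, C.discounted β f σ ω ∂(C.P x) = ∫ ω in {ω | σ ω ≠ ⊤},
      Real.exp (-β * ((σ ω).untopD 0 : ℝ≥0)) *
        C.futureReward β (β • f - Q.mulVec f) ((σ ω).untopD 0) ω ∂(C.P x) := by
  set g := β • f - Q.mulVec f with hg
  set K := ∫ u in Set.Ioi (0 : ℝ), Real.exp (-β * u) * ∑ z, |g z|
  have hfm : Measurable fun p : ℝ≥0 × Ω => Real.exp (-β * p.1) * f (C.X p.1 p.2) :=
    Measurable.mul (by fun_prop) ((measurable_of_finite f).comp C.measurable_uncurry)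
  have hgm : Measurable fun p : ℝ≥0 × Ω => Real.exp (-β * p.1) * C.futureReward β g p.1 p.2 :=
    Measurable.mul (by fun_prop) (C.measurable_futureReward β g)
  have hfb (t : ℝ≥0) (ω : Ω) : |Real.exp (-β * t) * f (C.X t ω)| ≤ ∑ z, |f z| := by
    rw [abs_mul, Real.abs_exp, ← one_mul (∑ z, |f z|)]
    gcongr
    exacts [exp_neg_mul_le_one hβ _, abs_le_sum_abs f _]
  have hgb (t : ℝ≥0) (ω : Ω) : |Real.exp (-β * t) * C.futureReward β g t ω| ≤ K := by
    rw [abs_mul, Real.abs_exp, ← one_mul K]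
    gcongr
    exacts [exp_neg_mul_le_one hβ _, C.abs_futureReward_le hβ g _ _]
  have hpair : Measurable fun ω => ((σ ω).untopD 0, ω) := hσ.measurable_untopD.prodMk measurable_id
  -- This `D` looks into the future and need not be adapted; optional stopping only uses its
  -- vanishing integrals over past events.
  have key := hσ.setIntegral_eq_zero (μ := C.P x)
    (D := fun t ω => Real.exp (-β * t) * f (C.X t ω) - Real.exp (-β * t) * C.futureReward β g t ω)
    (B := ∑ z, |f z| + K) (hfm.sub hgm)
    (fun t ω => (abs_sub _ _).trans (add_le_add (hfb t ω) (hgb t ω)))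
    (fun ω t => by
      have h1 : ContinuousWithinAt (fun s : ℝ≥0 => Real.exp (-β * s)) (Set.Ici t) t :=
        Continuous.continuousWithinAt (by fun_prop)
      exact (h1.mul (C.continuousWithinAt_comp f ω t)).sub
        (h1.mul (C.continuousWithinAt_futureReward hβ g ω t)))
    (fun t A hA => by
      rw [integral_sub ((C.integrable_comp f t x).const_mul _).integrableOn
        ((C.integrable_futureReward hβ g t x).const_mul _).integrableOn, integral_const_mul, integral_const_mul,
        C.setIntegral_futureReward hβ f x t hA, sub_self])
  have hfi : Integrable (fun ω => Real.exp (-β * ((σ ω).untopD 0 : ℝ≥0)) *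
      f (C.X ((σ ω).untopD 0) ω)) ((C.P x).restrict {ω | σ ω ≠ ⊤}) :=
    Integrable.of_bound (hfm.comp hpair).aestronglyMeasurable _
      (Eventually.of_forall fun ω => hfb _ _)
  have hgi : Integrable (fun ω => Real.exp (-β * ((σ ω).untopD 0 : ℝ≥0)) *
      C.futureReward β g ((σ ω).untopD 0) ω) ((C.P x).restrict {ω | σ ω ≠ ⊤}) :=
    Integrable.of_bound (hgm.comp hpair).aestronglyMeasurable _
      (Eventually.of_forall fun ω => hgb _ _)
  rw [integral_sub hfi hgi, sub_eq_zero] at key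
  rw [discounted_eq, integral_indicator hσ.measurableSet_ne_top]
  exact key

/-- The shift `s = t + u` turns the discounted future rewards at all times into tails of one
integral, comparable path by path. -/
theorem exp_mul_futureReward (C : FiniteMarkovChain E Ω Q) (β : ℝ) (g : E → ℝ) (t : ℝ≥0) (ω : Ω) :
    Real.exp (-β * t) * C.futureReward β g t ω =
      ∫ s in Set.Ioi (t : ℝ), Real.exp (-β * s) * g (C.X s.toNNReal ω) := by
  have h := (measurePreserving_add_left (volume : Measure ℝ) t).setIntegral_preimage_emb
    (measurableEmbedding_addLeft (t : ℝ))
    (fun s => Real.exp (-β * s) * g (C.X s.toNNReal ω)) (Set.Ioi (t : ℝ))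
  rw [← h, futureReward, ← integral_const_mul]
  have hpre : (fun u : ℝ => (t : ℝ) + u) ⁻¹' Set.Ioi (t : ℝ) = Set.Ioi 0 := by
    ext u; simp
  rw [hpre]
  refine setIntegral_congr_fun measurableSet_Ioi fun u hu => ?_
  rw [Real.toNNReal_add t.coe_nonneg (le_of_lt hu), Real.toNNReal_coe, mul_add, Real.exp_add, mul_assoc]

theorem integral_futureReward_zero (C : FiniteMarkovChain E Ω Q) {β : ℝ} (hβ : 0 < β) (f : E → ℝ)
    (x : E) : ∫ ω, C.futureReward β (β • f - Q.mulVec f) 0 ω ∂(C.P x) = f x := by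
  have h := C.setIntegral_futureReward hβ f x 0 MeasurableSet.univ
  rw [setIntegral_univ, setIntegral_univ] at h
  rw [h]
  exact congrFun (C.transition_zero f) x

theorem integrableOn_exp_mul_comp (C : FiniteMarkovChain E Ω Q) {β : ℝ} (hβ : 0 < β) (g : E → ℝ)
    (ω : Ω) : IntegrableOn (fun s : ℝ => Real.exp (-β * s) * g (C.X s.toNNReal ω)) (Set.Ioi 0) := by
  refine integrableOn_exp_mul β hβ ?_ fun u => abs_le_sum_abs g _
  have h : Measurable fun u : ℝ => (((0 : ℝ≥0), ω), u) := by fun_prop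
  simpa [Function.comp_def] using (C.measurable_comp_add g).comp h

theorem futureReward_zero (C : FiniteMarkovChain E Ω Q) (β : ℝ) (g : E → ℝ) (ω : Ω) :
    C.futureReward β g 0 ω = ∫ s in Set.Ioi (0 : ℝ), Real.exp (-β * s) * g (C.X s.toNNReal ω) := by
  simp [futureReward]

/-! ### Stopping superharmonic and harmonic functions; the one-player problem. -/

/-- A `β`-superharmonic function bounds its discounted value at any stopping time. -/
theorem integral_discounted_le (C : FiniteMarkovChain E Ω Q) {β : ℝ} (hβ : 0 < β) {W : E → ℝ}
    (hW : ∀ y, 0 ≤ β * W y - (Q.mulVec W) y)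
    {σ : Ω → WithTop ℝ≥0} (hσ : IsStoppingTime C.filtration σ) (x : E) :
    ∫ ω, C.discounted β W σ ω ∂(C.P x) ≤ W x := by
  set g := β • W - Q.mulVec W with hg
  have hg0 (ω : Ω) (s : ℝ) : 0 ≤ Real.exp (-β * s) * g (C.X s.toNNReal ω) :=
    mul_nonneg (Real.exp_nonneg _) (hW _)
  rw [C.integral_discounted hβ W hσ x, ← C.integral_futureReward_zero hβ W x,
    ← integral_indicator hσ.measurableSet_ne_top]
  refine integral_mono_of_nonneg (Eventually.of_forall fun ω => ?_)
    (C.integrable_futureReward hβ g 0 x) (Eventually.of_forall fun ω => ?_)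
  · refine Set.indicator_nonneg (fun ω _ => ?_) ω
    rw [exp_mul_futureReward]
    exact integral_nonneg (hg0 ω)
  · rw [futureReward_zero]
    refine Set.indicator_apply_le' (fun _ => ?_) fun _ => integral_nonneg (hg0 ω)
    rw [exp_mul_futureReward]
    exact setIntegral_mono_set (C.integrableOn_exp_mul_comp hβ g ω)
      (Eventually.of_forall (hg0 ω)) (Set.Ioi_subset_Ioi (NNReal.coe_nonneg _)).eventuallyLE

/-- A function that is `β`-harmonic off `A` is preserved by stopping no later than the entrance
into `A`. -/
theorem integral_discounted_eq (C : FiniteMarkovChain E Ω Q) {β : ℝ} (hβ : 0 < β) {W : E → ℝ}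
    {A : Set E} (hW : ∀ y ∉ A, β * W y - (Q.mulVec W) y = 0)
    {σ : Ω → WithTop ℝ≥0} (hσ : IsStoppingTime C.filtration σ) (hσA : ∀ ω, σ ω ≤ C.hit A ω) (x : E) :
    ∫ ω, C.discounted β W σ ω ∂(C.P x) = W x := by
  set g := β • W - Q.mulVec W with hg
  have hg0 (ω : Ω) (s : ℝ) (hs : (s.toNNReal : WithTop ℝ≥0) < σ ω) :
      Real.exp (-β * s) * g (C.X s.toNNReal ω) = 0 :=
    mul_eq_zero_of_right _ (hW _ (C.notMem_of_lt_hit (hs.trans_le (hσA ω))))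
  rw [C.integral_discounted hβ W hσ x, ← C.integral_futureReward_zero hβ W x,
    ← integral_indicator hσ.measurableSet_ne_top]
  congr 1
  ext ω
  rw [futureReward_zero]
  cases h : σ ω with
  | top =>
    rw [Set.indicator_of_notMem (by simpa using h)]
    exact (integral_eq_zero_of_ae (Eventually.of_forall fun s =>
      hg0 ω s (h ▸ WithTop.coe_lt_top _))).symm
  | coe t =>
    rw [Set.indicator_of_mem (show σ ω ≠ ⊤ from h ▸ WithTop.coe_ne_top), exp_mul_futureReward, h, WithTop.untopD_coe,
      -- With closed half-lines the difference is `0 ≤ s < t`, where `g` vanishes along the path;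
      -- open ones would leave `s = t`, where it may not.
      ← integral_Ici_eq_integral_Ioi, ← integral_Ici_eq_integral_Ioi]
    refine (setIntegral_eq_of_subset_of_forall_sdiff_eq_zero measurableSet_Ici
      (Set.Ici_subset_Ici.2 t.2) fun s hs => hg0 ω s ?_).symm
    rw [h, WithTop.coe_lt_coe]
    exact (Real.toNNReal_lt_iff_lt_coe hs.1).2 (not_le.1 hs.2)

/-- The two times need only agree at `ω`: `min τ γ` is `τ` or `γ` according to the branch of the
payoff. -/
theorem discounted_mono (C : FiniteMarkovChain E Ω Q) {β : ℝ} {f g : E → ℝ}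
    {η η' : Ω → WithTop ℝ≥0} {ω : Ω} (hη : η ω = η' ω)
    (h : ∀ t : ℝ≥0, η ω = t → f (C.X t ω) ≤ g (C.X t ω)) :
    C.discounted β f η ω ≤ C.discounted β g η' ω := by
  classical
  rw [discounted, discounted, ← hη]
  split_ifs with htop
  · exact le_rfl
  · obtain ⟨t, ht⟩ := WithTop.ne_top_iff_exists.1 htop
    rw [← ht, WithTop.untopD_coe]
    gcongr
    exact h t ht.symm

theorem discounted_nonneg (C : FiniteMarkovChain E Ω Q) {β : ℝ} {f : E → ℝ} (hf : ∀ y, 0 ≤ f y)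
    (η : Ω → WithTop ℝ≥0) (ω : Ω) : 0 ≤ C.discounted β f η ω := by
  classical
  rw [discounted]
  split_ifs
  exacts [le_rfl, mul_nonneg (Real.exp_nonneg _) (hf _)]

/-- A solution of the obstacle problem is the value of the one-player stopping problem. -/
theorem stoppingValue_eq (C : FiniteMarkovChain E Ω Q) {β : ℝ} (hβ : 0 < β) {ψ W : E → ℝ}
    (hψW : ∀ y, ψ y ≤ W y) (hW : ∀ y, 0 ≤ β * W y - (Q.mulVec W) y)
    (hWψ : ∀ y, W y ≠ ψ y → β * W y - (Q.mulVec W) y = 0) : C.stoppingValue β ψ = W := by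
  ext x
  have hle (τ : C.stoppingTimes) : ∫ ω, C.discounted β ψ τ ω ∂(C.P x) ≤ W x :=
    (integral_mono (C.integrable_discounted hβ ψ τ.2 x) (C.integrable_discounted hβ W τ.2 x)
      fun ω => C.discounted_mono rfl fun t _ => hψW _).trans
      (C.integral_discounted_le hβ hW τ.2 x)
  have hst := C.isStoppingTime_hit {y | W y = ψ y}
  have : Nonempty C.stoppingTimes := ⟨⟨_, hst⟩⟩
  refine le_antisymm (ciSup_le hle) ?_
  refine le_ciSup_of_le ⟨W x, Set.forall_mem_range.2 hle⟩ ⟨_, hst⟩ ?_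
  rw [← C.integral_discounted_eq hβ (A := {y | W y = ψ y}) hWψ hst (fun ω => le_rfl) x]
  exact integral_mono (C.integrable_discounted hβ W hst x) (C.integrable_discounted hβ ψ hst x)
    fun ω => C.discounted_mono rfl fun t ht => (C.mem_of_hit_eq_coe ht).le

/-! ### The game: payoff bounds and saddle point. -/

open Classical in
theorem integrable_payoff (C : FiniteMarkovChain E Ω Q) {β : ℝ} (hβ : 0 < β) (ψ φ : E → ℝ)
    {τ γ : Ω → WithTop ℝ≥0} (hτ : IsStoppingTime C.filtration τ)
    (hγ : IsStoppingTime C.filtration γ) (x : E) :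
    Integrable (fun ω => if τ ω ≤ γ ω then C.discounted β ψ τ ω else C.discounted β φ γ ω)
      (C.P x) := by
  refine (Integrable.piecewise (measurableSet_le hτ.measurable' hγ.measurable')
    (C.integrable_discounted hβ ψ hτ x).integrableOn
    (C.integrable_discounted hβ φ hγ x).integrableOn).congr (Eventually.of_forall fun ω => ?_)
  by_cases h : τ ω ≤ γ ω <;> simp [Set.piecewise, h]

/-- Together with `payoff_le`, this makes the real-valued `⨆` and `⨅` over stopping times genuine
extrema rather than default values. -/
theorem payoff_nonneg (C : FiniteMarkovChain E Ω Q) {β : ℝ} {ψ φ : E → ℝ} (hψ : ∀ y, 0 ≤ ψ y)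
    (hφ : ∀ y, 0 ≤ φ y) (τ γ : Ω → WithTop ℝ≥0) (x : E) : 0 ≤ C.payoff β ψ φ x τ γ := by
  classical
  refine integral_nonneg fun ω => ?_
  dsimp only [Pi.zero_apply]
  split_ifs
  exacts [C.discounted_nonneg hψ τ ω, C.discounted_nonneg hφ γ ω]

theorem payoff_le (C : FiniteMarkovChain E Ω Q) {β : ℝ} (hβ : 0 < β) (ψ φ : E → ℝ)
    (τ γ : Ω → WithTop ℝ≥0) (x : E) :
    C.payoff β ψ φ x τ γ ≤ ∑ z, |ψ z| + ∑ z, |φ z| := by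
  classical
  have h := norm_integral_le_of_norm_le_const (μ := C.P x) (C := ∑ z, |ψ z| + ∑ z, |φ z|)
    (f := fun ω => if τ ω ≤ γ ω then C.discounted β ψ τ ω else C.discounted β φ γ ω)
    (Eventually.of_forall fun ω => by
      have h1 := C.abs_discounted_le hβ ψ τ ω
      have h2 := C.abs_discounted_le hβ φ γ ω
      have h3 : 0 ≤ ∑ z, |ψ z| := Finset.sum_nonneg fun z _ => abs_nonneg _
      have h4 : 0 ≤ ∑ z, |φ z| := Finset.sum_nonneg fun z _ => abs_nonneg _
      rw [Real.norm_eq_abs]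
      split_ifs <;> linarith)
  rw [probReal_univ, mul_one] at h
  exact (le_abs_self _).trans h

/-- Pathwise, the payoff is below the discounted `W` at `min τ γ*`: `ψ ≤ W` in one branch, `φ = W`
on entrance in the other. -/
theorem payoff_le_of_superharmonic (C : FiniteMarkovChain E Ω Q) {β : ℝ} (hβ : 0 < β)
    {ψ φ W : E → ℝ} (hψW : ∀ y, ψ y ≤ W y) (hW : ∀ y, 0 ≤ β * W y - (Q.mulVec W) y)
    {τ : Ω → WithTop ℝ≥0} (hτ : IsStoppingTime C.filtration τ) (x : E) :
    C.payoff β ψ φ x τ (C.hit {y | W y = φ y}) ≤ W x := by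
  classical
  have hγ := C.isStoppingTime_hit {y | W y = φ y}
  refine le_trans ?_ (C.integral_discounted_le hβ hW (hτ.min hγ) x)
  refine integral_mono (C.integrable_payoff hβ ψ φ hτ hγ x)
    (C.integrable_discounted hβ W (hτ.min hγ) x) fun ω => ?_
  dsimp only
  split_ifs with h
  · exact C.discounted_mono (min_eq_left h).symm fun t _ => hψW _
  · exact C.discounted_mono (min_eq_right (not_le.1 h).le).symm
      fun t ht => (C.mem_of_hit_eq_coe ht).ge

/-- The mirror argument at `min τ* γ`, which never exceeds the entrance time into `{W = ψ}`, so that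
`W` is preserved exactly. -/
theorem le_payoff_of_harmonic (C : FiniteMarkovChain E Ω Q) {β : ℝ} (hβ : 0 < β)
    {ψ φ W : E → ℝ} (hWφ : ∀ y, W y ≤ φ y)
    (hWψ : ∀ y, W y ≠ ψ y → β * W y - (Q.mulVec W) y = 0)
    {γ : Ω → WithTop ℝ≥0} (hγ : IsStoppingTime C.filtration γ) (x : E) :
    W x ≤ C.payoff β ψ φ x (C.hit {y | W y = ψ y}) γ := by
  classical
  have hτ := C.isStoppingTime_hit {y | W y = ψ y}
  rw [← C.integral_discounted_eq hβ (A := {y | W y = ψ y}) hWψ (hτ.min hγ)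
    (fun ω => min_le_left _ _) x]
  refine integral_mono (C.integrable_discounted hβ W (hτ.min hγ) x)
    (C.integrable_payoff hβ ψ φ hτ hγ x) fun ω => ?_
  dsimp only
  split_ifs with h
  · exact C.discounted_mono (min_eq_left h)
      fun t ht => (C.mem_of_hit_eq_coe ((min_eq_left h).symm.trans ht)).le
  · exact C.discounted_mono (min_eq_right (not_le.1 h).le) fun t _ => hWφ _

/-- A saddle point of the payoff determines the value of the game. -/
theorem hasValue_of_saddle (C : FiniteMarkovChain E Ω Q) {β : ℝ} (hβ : 0 < β) {ψ φ W : E → ℝ}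
    (hψ : ∀ y, 0 ≤ ψ y) (hφ : ∀ y, 0 ≤ φ y) {τ' γ' : Ω → WithTop ℝ≥0}
    (hτ' : τ' ∈ C.stoppingTimes) (hγ' : γ' ∈ C.stoppingTimes)
    (hle : ∀ x, ∀ τ ∈ C.stoppingTimes, C.payoff β ψ φ x τ γ' ≤ W x)
    (hge : ∀ x, ∀ γ ∈ C.stoppingTimes, W x ≤ C.payoff β ψ φ x τ' γ) : C.HasValue β ψ φ W := by
  intro x
  have : Nonempty C.stoppingTimes := ⟨⟨_, hτ'⟩⟩
  have hbelow (τ : C.stoppingTimes) :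
      BddBelow (Set.range fun γ : C.stoppingTimes => C.payoff β ψ φ x τ γ) :=
    ⟨0, Set.forall_mem_range.2 fun γ => C.payoff_nonneg hψ hφ τ γ x⟩
  have habove (γ : C.stoppingTimes) :
      BddAbove (Set.range fun τ : C.stoppingTimes => C.payoff β ψ φ x τ γ) :=
    ⟨_, Set.forall_mem_range.2 fun τ => C.payoff_le hβ ψ φ τ γ x⟩
  have hinf (τ : C.stoppingTimes) : ⨅ γ : C.stoppingTimes, C.payoff β ψ φ x τ γ ≤ W x :=
    ciInf_le_of_le (hbelow τ) ⟨γ', hγ'⟩ (hle x τ τ.2)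
  have hsup (γ : C.stoppingTimes) : W x ≤ ⨆ τ : C.stoppingTimes, C.payoff β ψ φ x τ γ :=
    le_ciSup_of_le (habove γ) ⟨τ', hτ'⟩ (hge x γ γ.2)
  exact ⟨le_antisymm (ciSup_le hinf) (le_ciSup_of_le ⟨W x, Set.forall_mem_range.2 hinf⟩ ⟨τ', hτ'⟩
      (le_ciInf fun γ => hge x γ γ.2)),
    le_antisymm (ciInf_le_of_le ⟨W x, Set.forall_mem_range.2 hsup⟩ ⟨γ', hγ'⟩
      (ciSup_le fun τ => hle x τ τ.2)) (le_ciInf hsup)⟩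

end FiniteMarkovChain

theorem theorem3p3 {E Ω : Type*} [Fintype E] [TopologicalSpace E] [DiscreteTopology E]
    [MeasurableSpace E] [BorelSpace E] [MeasurableSpace Ω]
    (Q : Matrix E E ℝ) (hQ : IsMarkovGenerator Q) (C : FiniteMarkovChain E Ω Q)
    (β : ℝ) (hβ : 0 < β) (ψ φ : E → ℝ) (hψ : ∀ x, 0 ≤ ψ x) (hψφ : ∀ x, ψ x ≤ φ x)
    (hV₀ : ∀ x, C.stoppingValue β ψ x ≤ φ x) :
    C.HasValue β ψ φ (C.stoppingValue β ψ) ∧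
      C.IsNashEquilibrium β ψ φ
        (C.hit {x | C.stoppingValue β ψ x = ψ x})
        (C.hit {x | C.stoppingValue β ψ x = φ x}) := by
  obtain ⟨W, hψW, hW, hWψ⟩ := hQ.exists_obstacle_solution hβ ψ
  -- Replaces `V₀` by `W` also inside the hitting sets; the hypothesis becomes `W ≤ φ`.
  rw [C.stoppingValue_eq hβ hψW hW hWψ] at hV₀ ⊢
  have hτ := C.isStoppingTime_hit {x | W x = ψ x}
  have hγ := C.isStoppingTime_hit {x | W x = φ x}
  have hle (x : E) (τ : Ω → WithTop ℝ≥0) (h : τ ∈ C.stoppingTimes) :=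
    C.payoff_le_of_superharmonic (φ := φ) hβ hψW hW h x
  have hge (x : E) (γ : Ω → WithTop ℝ≥0) (h : γ ∈ C.stoppingTimes) :=
    C.le_payoff_of_harmonic (φ := φ) hβ hV₀ hWψ h x
  exact ⟨C.hasValue_of_saddle hβ hψ (fun x => (hψ x).trans (hψφ x)) hτ hγ hle hge, hτ, hγ,
    fun x τ h1 γ h2 => ⟨(hle x τ h1).trans (hge x _ hγ), (hle x _ hτ).trans (hge x γ h2)⟩⟩
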